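/- Let $\mathcal X$ be a measurable space (for instance a bounded smooth domain in $\mathbb R^n$ with its Borel $\sigma$-algebra), and let $H$ be a real reproducing kernel Hilbert space of functions on $\mathcal X$ whose kernel $k$ is bounded and such that $k(\cdot,y)$ is measurable for every $y\in\mathcal X$. Let $\mu$ be a finite positive measure on $\mathcal X$, let $\iota_\mu:H\to L^2(\mu)$ be the embedding, let $U$ be a real separable Hilbert space, let $A:U\to H$ be linear and bounded, and put $A_\mu=\iota_\mu A:U\to L^2(\mu)$. Let $\{e_j\}_{j\in\mathbb J}$, with $\mathbb J\subset\{1,2,3,\dots\}$ finite or infinite, be an orthonormal basis of $L^2(\mu)$. For $t\in\mathbb R$ let $Z_t^\mu$ be the Hilbert space of formal series $z=\sum_{j\in\mathbb J}z_je_j$ with $\sum_j j^{2t}z_j^2<\infty$, with inner product $\langle z,w\rangle_{Z_t^\mu}=\sum_j j^{2t}z_jw_j$, and fix $s\in\mathbb R$ such that $\sum_{j\in\mathbb J}j^{-2s}<\infty$; then $L^2(\mu)=Z_0^\mu$ embeds continuously into $Z_{-s}^\mu$. Let $\epsilon_\mu=(\epsilon_\mu(h))_{h\in L^2(\mu)}$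 be an isonormal Gaussian process over $L^2(\mu)$, that is, a centred Gaussian family with $\mathbb E[\epsilon_\mu(h)\epsilon_\mu(k)]=\langle h,k\rangle_{L^2(\mu)}$. Then the series $\sum_{j\in\mathbb J}\epsilon_\mu(e_j)e_j$ converges in $L^2(\Omega;Z_{-s}^\mu)$ to a random element $\tilde\epsilon_\mu$ of $Z^\mu_{-s}$, which satisfies $\langle\tilde\epsilon_\mu,h\rangle_{Z_{-s}^\mu\times Z_s^\mu}=\epsilon_\mu(h)$ almost surely for every $h\in L^2(\mu)\cap Z_s^\mu$. Let $(g_\mu,f)$ be a random variable with values in $Z_{-s}^\mu\times U$ whose joint law is determined as follows: $f\sim\mathcal N(0,C_f)$, a Gaussian measure on $U$ with mean zero and covariance operator $C_f$, and the conditional law of $g_\mu$ given $f=u$ is the law of $A_\mu u+\tilde\epsilon_\mu$ (this is the model $g_\mu(h)=\langle A_\mu f,h\rangle_{L^2(\mu)}+\epsilon_\mu(h)$ with noise independent of $f$, realised in $Z_{-s}^\mu$). Then $A_\mu C_fA_\mu^*+I$ is boundedly invertible on $L^2(\mu)$, where $A_\mu^*$ is the adjoint of $A_\mu:U\to L^2(\mu)$,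 and the operator $$C_{post}^\mu=C_f-C_fA_\mu^*\left(A_\mu C_fA_\mu^*+I\right)^{-1}A_\mu C_f:U\to U$$ is trace class. Moreover, the conditional distribution of $f$ given $g_\mu$ has a regular version, i.e. a Markov kernel $\kappa$ from $Z_{-s}^\mu$ to $U$, such that for every $z\in Z_{-s}^\mu$ the measure $\kappa(z,\cdot)$ is Gaussian with covariance operator $C_{post}^\mu$. -/

import Mathlib

open MeasureTheory ProbabilityTheory Filter Topology
open scoped RealInnerProductSpace ENNReal lp

noncomputable section

namespace WhiteNoiseModel

/-! ### The embedding of a reproducing kernel Hilbert space into `L²(μ)` -/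

section Embedding

variable {𝒳 H : Type*} [MeasurableSpace 𝒳]
  [NormedAddCommGroup H] [InnerProductSpace ℝ H] [CompleteSpace H] [RKHS ℝ H 𝒳 ℝ]

variable (H) in
/-- The scalar reproducing kernel `k(x, y)` of a real reproducing kernel Hilbert space. -/
def scalarKernel (x y : 𝒳) : ℝ := RKHS.kernel H x y 1

variable (H) in
/-- The reproducing kernel is bounded and measurable in its first variable. -/
structure IsAdmissibleKernel : Prop where
  measurable : ∀ y : 𝒳, Measurable fun x => scalarKernel H x y
  bounded : ∃ M : ℝ, ∀ x y : 𝒳, |scalarKernel H x y| ≤ M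

theorem measurable_coe (hk : IsAdmissibleKernel H) (h : H) : Measurable (h : 𝒳 → ℝ) := by
  have hmem : h ∈ (Submodule.span ℝ
      {RKHS.kerFun H x v | (x : 𝒳) (v : ℝ)}).topologicalClosure := by
    rw [RKHS.kerFun_dense]; trivial
  rw [← SetLike.mem_coe, Submodule.topologicalClosure_coe, mem_closure_iff_seq_limit] at hmem
  obtain ⟨u, hu, hlim⟩ := hmem
  have hspan : ∀ g ∈ Submodule.span ℝ {RKHS.kerFun H x v | (x : 𝒳) (v : ℝ)},
      Measurable (g : 𝒳 → ℝ) := by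
    intro g hg
    induction hg using Submodule.span_induction with
    | mem g hg =>
      obtain ⟨y, v, rfl⟩ := hg
      have : (RKHS.kerFun H y v : 𝒳 → ℝ) = fun x => v * scalarKernel H x y := by
        funext x
        rw [RKHS.kerFun_apply, scalarKernel]
        conv_lhs => rw [show v = v • (1 : ℝ) by simp, map_smul]
        simp
      rw [this]
      exact (hk.measurable y).const_mul v
    | zero => rw [RKHS.coe_zero]; exact measurable_zero
    | add a b _ _ ha hb => rw [RKHS.coe_add]; exact ha.add hb
    | smul c a _ ha => rw [RKHS.coe_smul]; exact ha.const_smul c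
  refine measurable_of_tendsto_metrizable (fun n => hspan (u n) (hu n)) ?_
  rw [tendsto_pi_nhds]
  exact fun x => ((RKHS.continuous_eval x).tendsto h).comp hlim

theorem exists_bound (hk : IsAdmissibleKernel H) :
    ∃ C : ℝ, 0 ≤ C ∧ ∀ (h : H) (x : 𝒳), ‖h x‖ ≤ C * ‖h‖ := by
  obtain ⟨M, hM⟩ := hk.bounded
  refine ⟨√M, Real.sqrt_nonneg _, fun h x => ?_⟩
  refine (RKHS.norm_apply_le h x).trans ?_
  rw [mul_comm]
  gcongr
  have h1 : ‖RKHS.kernel H x x‖ = ‖RKHS.kernel H x x 1‖ := by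
    refine le_antisymm ?_ ?_
    · refine ContinuousLinearMap.opNorm_le_bound _ (norm_nonneg _) fun v => ?_
      conv_lhs => rw [show v = v • (1 : ℝ) by simp, map_smul, norm_smul]
      rw [mul_comm]
    · simpa using (RKHS.kernel H x x).le_opNorm 1
  rw [h1]
  exact hM x x

theorem memLp_coe (hk : IsAdmissibleKernel H) (μ : Measure 𝒳) [IsFiniteMeasure μ] (h : H) :
    MemLp (h : 𝒳 → ℝ) 2 μ := by
  obtain ⟨C, -, hC⟩ := exists_bound hk
  exact MemLp.of_bound (measurable_coe hk h).aestronglyMeasurable (C * ‖h‖)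
    (Eventually.of_forall (hC h))

/-- The embedding `ι_μ : H → L²(μ)`, sending `h` to the class of the function `x ↦ h x`. -/
def embedding (hk : IsAdmissibleKernel H) (μ : Measure 𝒳) [IsFiniteMeasure μ] :
    H →L[ℝ] Lp ℝ 2 μ :=
  LinearMap.mkContinuousOfExistsBound
    { toFun := fun h => (memLp_coe hk μ h).toLp (h : 𝒳 → ℝ)
      map_add' := fun a b => by
        rw [← MemLp.toLp_add]
        exact MemLp.toLp_congr _ _ (by rw [RKHS.coe_add])
      map_smul' := fun c a => by
        rw [RingHom.id_apply, ← MemLp.toLp_const_smul]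
        exact MemLp.toLp_congr _ _ (by rw [RKHS.coe_smul]) }
    (by
      obtain ⟨C, hC0, hC⟩ := exists_bound hk
      refine ⟨(measureUnivNNReal μ : ℝ) ^ ((2 : ℝ≥0∞).toReal)⁻¹ * C, fun h => ?_⟩
      rw [mul_assoc]
      refine Lp.norm_le_of_ae_bound (by positivity) ?_
      filter_upwards [(memLp_coe hk μ h).coeFn_toLp] with x hx
      simp only [LinearMap.coe_mk, AddHom.coe_mk]
      rw [hx]
      exact hC h x)

end Embedding

/-! ### Isonormal processes -/

/-- An isonormal Gaussian process over the real Hilbert space `E`: a centred Gaussian family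
`(ε h)` indexed by `h ∈ E` with `𝔼[ε h * ε k] = ⟪h, k⟫`. -/
structure IsIsonormal {E Ω : Type*} [NormedAddCommGroup E] [InnerProductSpace ℝ E]
    [MeasurableSpace Ω] (ε : E → Ω → ℝ) (P : Measure Ω) : Prop where
  gaussian : IsGaussianProcess ε P
  mean_zero : ∀ h, ∫ ω, ε h ω ∂P = 0
  cov : ∀ h k, ∫ ω, ε h ω * ε k ω ∂P = ⟪h, k⟫

/-! ### The Hilbert scale -/

/-- The vector space `Z_t` of (formal) series `∑ z_j e_j` with `∑ j^{2t} z_j² < ∞`, represented by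
the coefficient sequences. The index set `J` is a set of positive integers. -/
def scaleSubmodule (J : Set ℕ+) (t : ℝ) : Submodule ℝ (J → ℝ) where
  carrier := {z | Summable fun j : J => ((j : ℕ+) : ℝ) ^ (2 * t) * z j ^ 2}
  zero_mem' := by simp
  add_mem' := by
    intro a b ha hb
    refine Summable.of_nonneg_of_le (fun j => by positivity) (fun j => ?_)
      ((ha.mul_left 2).add (hb.mul_left 2))
    have h0 : (0 : ℝ) ≤ ((j : ℕ+) : ℝ) ^ (2 * t) := by positivity
    have h1 : (a j + b j) ^ 2 ≤ 2 * a j ^ 2 + 2 * b j ^ 2 := by nlinarith [sq_nonneg (a j - b j)]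
    calc _ ≤ ((j : ℕ+) : ℝ) ^ (2 * t) * (2 * a j ^ 2 + 2 * b j ^ 2) :=
          mul_le_mul_of_nonneg_left h1 h0
      _ = _ := by ring
  smul_mem' := by
    intro c a ha
    refine (ha.mul_left (c ^ 2)).congr fun j => ?_
    simp only [Pi.smul_apply, smul_eq_mul]
    ring

/-- The space `Z_t` as a type, to be given the inner product `∑ j^{2t} z_j w_j`. -/
def HilbertScale (J : Set ℕ+) (t : ℝ) : Type := scaleSubmodule J t

namespace HilbertScale

variable {J : Set ℕ+} {t : ℝ}

instance : AddCommGroup (HilbertScale J t) := inferInstanceAs (AddCommGroup (scaleSubmodule J t))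

instance : Module ℝ (HilbertScale J t) := inferInstanceAs (Module ℝ (scaleSubmodule J t))

/-- The coefficient sequence of an element of `Z_t`. -/
def coeff : HilbertScale J t →ₗ[ℝ] (J → ℝ) := (scaleSubmodule J t).subtype

theorem weight_pos (t : ℝ) (j : J) : 0 < ((j : ℕ+) : ℝ) ^ t := by
  have : (0 : ℝ) < ((j : ℕ+) : ℝ) := by exact_mod_cast (j : ℕ+).pos
  positivity

theorem weight_sq (t : ℝ) (j : J) (x : ℝ) :
    ‖((j : ℕ+) : ℝ) ^ t * x‖ ^ (2 : ℝ≥0∞).toReal = ((j : ℕ+) : ℝ) ^ (2 * t) * x ^ 2 := by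
  have h0 : (0 : ℝ) ≤ ((j : ℕ+) : ℝ) := by positivity
  simp only [ENNReal.toReal_ofNat, Real.rpow_two, Real.norm_eq_abs, sq_abs]
  rw [mul_pow, ← Real.rpow_natCast, ← Real.rpow_mul h0, mul_comm t]
  norm_num

/-- The linear bijection `z ↦ (j^t z_j)` of `Z_t` with `ℓ²(J)`, through which `Z_t` gets its inner
product (see `inner_eq`). -/
def toL2 : HilbertScale J t ≃ₗ[ℝ] ℓ²(J, ℝ) where
  toFun z := ⟨fun j => ((j : ℕ+) : ℝ) ^ t * coeff z j,
    memℓp_gen (by simp only [weight_sq]; exact z.2)⟩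
  invFun w := ⟨fun j => (((j : ℕ+) : ℝ) ^ t)⁻¹ * w j, by
    have h := (lp.memℓp w).summable (by norm_num)
    refine h.congr fun j => ?_
    rw [← weight_sq, mul_inv_cancel_left₀ (weight_pos t j).ne']⟩
  map_add' a b := by
    ext j
    change _ * coeff (a + b) j = _ * coeff a j + _ * coeff b j
    rw [map_add, Pi.add_apply, mul_add]
  map_smul' c a := by
    ext j
    change _ * coeff (c • a) j = c * (_ * coeff a j)
    rw [map_smul, Pi.smul_apply, smul_eq_mul]
    ring
  left_inv z := Subtype.ext (funext fun j => inv_mul_cancel_left₀ (weight_pos t j).ne' _)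
  right_inv w := by
    ext j
    exact mul_inv_cancel_left₀ (weight_pos t j).ne' _

instance : NormedAddCommGroup (HilbertScale J t) :=
  NormedAddCommGroup.induced _ _ (toL2 : HilbertScale J t ≃ₗ[ℝ] ℓ²(J, ℝ)).toLinearMap
    toL2.injective

theorem norm_toL2 (z : HilbertScale J t) : ‖toL2 z‖ = ‖z‖ := rfl

instance : InnerProductSpace ℝ (HilbertScale J t) where
  inner z w := ⟪toL2 z, toL2 w⟫
  norm_smul_le c z := by
    rw [← norm_toL2, map_smul, norm_smul, norm_toL2]
  norm_sq_eq_re_inner z := by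
    rw [← norm_toL2]; exact norm_sq_eq_re_inner (𝕜 := ℝ) _
  conj_inner_symm z w := inner_conj_symm (𝕜 := ℝ) _ _
  add_left z w v := by rw [map_add, inner_add_left]
  smul_left z w c := by rw [map_smul, inner_smul_left]

/-- `Z_t` is isometric to `ℓ²(J)`. -/
def isometryL2 : HilbertScale J t ≃ₗᵢ[ℝ] ℓ²(J, ℝ) := ⟨toL2, norm_toL2⟩

theorem inner_eq (z w : HilbertScale J t) :
    ⟪z, w⟫ = ∑' j : J, ((j : ℕ+) : ℝ) ^ (2 * t) * (coeff z j * coeff w j) := by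
  change ⟪toL2 z, toL2 w⟫ = _
  rw [lp.inner_eq_tsum]
  refine tsum_congr fun j => ?_
  have h0 : (0 : ℝ) < ((j : ℕ+) : ℝ) := by exact_mod_cast (j : ℕ+).pos
  change inner ℝ (_ * coeff z j) (_ * coeff w j) = _
  rw [two_mul, Real.rpow_add h0]
  simp only [RCLike.inner_apply, conj_trivial]
  ring

instance : CompleteSpace (HilbertScale J t) :=
  (completeSpace_congr (isometryL2 (J := J) (t := t)).isometry.isUniformEmbedding
    (e := isometryL2.toEquiv)).2 inferInstance

instance : SecondCountableTopology (HilbertScale J t) := by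
  let b : HilbertBasis J ℝ (HilbertScale J t) := ⟨isometryL2⟩
  have h1 : TopologicalSpace.IsSeparable
      ((Submodule.span ℝ (Set.range b)).topologicalClosure : Set (HilbertScale J t)) :=
    ((Set.countable_range b).isSeparable.span).closure
  rw [b.dense_span] at h1
  have : TopologicalSpace.SeparableSpace (HilbertScale J t) :=
    TopologicalSpace.isSeparable_univ_iff.1 h1
  exact UniformSpace.secondCountable_of_separable _

instance : MeasurableSpace (HilbertScale J t) := borel _

instance : BorelSpace (HilbertScale J t) := ⟨rfl⟩

open Classical in
/-- The element `∑ z_j e_j` of `Z_t` with prescribed coefficients; it is `0` if the coefficients do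
not satisfy the summability condition. -/
def ofCoeff (t : ℝ) (z : J → ℝ) : HilbertScale J t :=
  if h : z ∈ scaleSubmodule J t then (⟨z, h⟩ : scaleSubmodule J t) else 0

end HilbertScale

section Model

variable {E : Type*} [NormedAddCommGroup E] [InnerProductSpace ℝ E]
  {J : Set ℕ+} (e : HilbertBasis J ℝ E)

theorem repr_mem_scale {s : ℝ} (hs : Summable fun j : J => ((j : ℕ+) : ℝ) ^ (-2 * s)) (h : E) :
    (fun j => e.repr h j) ∈ scaleSubmodule J (-s) := by
  refine Summable.of_nonneg_of_le (fun j => by positivity) (fun j => ?_) (hs.mul_left (‖h‖ ^ 2))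
  have h1 : |e.repr h j| ≤ ‖h‖ := by
    rw [← e.repr.norm_map h]; exact lp.norm_apply_le_norm two_ne_zero (e.repr h) j
  have h2 : e.repr h j ^ 2 ≤ ‖h‖ ^ 2 := by
    rw [← sq_abs]; exact pow_le_pow_left₀ (abs_nonneg _) h1 2
  rw [show 2 * -s = -2 * s by ring, mul_comm]
  exact mul_le_mul_of_nonneg_right h2 (by positivity)

/-- The canonical embedding of `Z_0 = E` into `Z_{-s}`, sending `h = ∑ ⟪e_j, h⟫ e_j` to its
coefficient sequence. -/
def toScale {s : ℝ} (hs : Summable fun j : J => ((j : ℕ+) : ℝ) ^ (-2 * s)) :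
    E →L[ℝ] HilbertScale J (-s) :=
  LinearMap.mkContinuousOfExistsBound
    { toFun := fun h => (⟨fun j => e.repr h j, repr_mem_scale e hs h⟩ : scaleSubmodule J (-s))
      map_add' := fun a b => Subtype.ext (funext fun j => by simp; rfl)
      map_smul' := fun c a => Subtype.ext (funext fun j => by simp; rfl) }
    (by
      refine ⟨√(∑' j : J, ((j : ℕ+) : ℝ) ^ (-2 * s)), fun h => ?_⟩
      refine (sq_le_sq₀ (norm_nonneg _) (by positivity)).1 ?_
      rw [mul_pow, Real.sq_sqrt (tsum_nonneg fun j => by positivity),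
        ← real_inner_self_eq_norm_sq, HilbertScale.inner_eq, ← tsum_mul_right]
      have hle : ∀ j : J, ((j : ℕ+) : ℝ) ^ (2 * -s) * (e.repr h j * e.repr h j) ≤
          ((j : ℕ+) : ℝ) ^ (-2 * s) * ‖h‖ ^ 2 := fun j => by
        have h1 : |e.repr h j| ≤ ‖h‖ := by
          rw [← e.repr.norm_map h]; exact lp.norm_apply_le_norm two_ne_zero (e.repr h) j
        rw [show 2 * -s = -2 * s by ring, ← sq, ← sq_abs]
        gcongr
      exact Summable.tsum_le_tsum hle
        (Summable.of_nonneg_of_le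
          (fun j => mul_nonneg (by positivity) (mul_self_nonneg _)) hle (hs.mul_right _))
        (hs.mul_right _))

/-- The realisation `ε̃ = ∑ ε(e_j) e_j` of a process `ε` indexed by `E` as a random element
of `Z_{-s}`. -/
def realisation (s : ℝ) {Ω : Type*} (ε : E → Ω → ℝ) (ω : Ω) : HilbertScale J (-s) :=
  HilbertScale.ofCoeff (-s) fun j => ε (e j) ω

end Model

/-- The likelihood of the additive observation model `g = T u + noise`: given `u`, the law
of `T u + η` where `η` has law `ν`. -/
def likelihood {U Z : Type*} [NormedAddCommGroup U] [NormedSpace ℝ U] [MeasurableSpace U]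
    [BorelSpace U] [NormedAddCommGroup Z] [NormedSpace ℝ Z] [MeasurableSpace Z] [BorelSpace Z]
    [SecondCountableTopology Z] (T : U →L[ℝ] Z) (ν : Measure Z) [SFinite ν] : Kernel U Z where
  toFun u := ν.map fun η => T u + η
  measurable' := by
    refine Measure.measurable_of_measurable_coe _ fun s hs => ?_
    have hm : Measurable fun p : U × Z => T p.1 + p.2 :=
      (T.measurable.comp measurable_fst).add measurable_snd
    have := measurable_measure_prodMk_left (ν := ν) (hm hs)
    convert! this using 2 with u
    rw [Measure.map_apply (by fun_prop) hs]
    rfl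

section Operators

variable {U : Type*} [NormedAddCommGroup U] [InnerProductSpace ℝ U] [CompleteSpace U]

/-- `C` is the (centred) covariance operator of the measure `ν`. -/
def HasCovariance [MeasurableSpace U] [BorelSpace U] (ν : Measure U) (C : U →L[ℝ] U) : Prop :=
  MemLp id 2 ν ∧ ∀ u v, covarianceBilin ν u v = ⟪C u, v⟫

/-- A bounded operator `T` is trace class if its absolute value `S = |T|`, the positive operator
with `S² = T* T`, has finite trace: `∑ ⟪S b_i, b_i⟫ < ∞` for every orthonormal basis. -/
def IsTraceClass (T : U →L[ℝ] U) : Prop :=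
  ∃ S : U →L[ℝ] U, S.IsPositive ∧ S ∘L S = T.adjoint ∘L T ∧
    ∀ (w : Set U) (b : HilbertBasis w ℝ U), Summable fun i => ⟪S (b i), b i⟫

variable {E : Type*} [NormedAddCommGroup E] [InnerProductSpace ℝ E] [CompleteSpace E]

/-- The operator `T C T* + I` on `E`. -/
def dataCovariance (C : U →L[ℝ] U) (T : U →L[ℝ] E) : E →L[ℝ] E :=
  T ∘L C ∘L T.adjoint + ContinuousLinearMap.id ℝ E

/-- The operator `C - C T* (T C T* + I)⁻¹ T C`. Here `Ring.inverse` is the inverse of an invertible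
operator (and `0` for one that is not invertible). -/
def posteriorCovariance (C : U →L[ℝ] U) (T : U →L[ℝ] E) : U →L[ℝ] U :=
  C - C ∘L T.adjoint ∘L Ring.inverse (dataCovariance C T) ∘L T ∘L C

end Operators

end WhiteNoiseModel

end

noncomputable section

namespace WhiteNoiseModel

/-! ### Isonormal processes as isometries, and noise series in Hilbert spaces -/

/-! Write `C` for the prior covariance, `T` for the forward operator and `K = C T* (T C T* + I)⁻¹`
for the gain. On the product of the prior and the noise space, the data are `G = T f + ε̃`. The
candidate posterior mean is `m(G) = K G`, and everything rests on the residual `D = f - m(G)` being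
independent of `G`: then `f = m(G) + D`, so the law of `f` given `G = z` is the law of `D`
translated by `m(z)`, and its covariance does not depend on `z`.

White noise does not live in `L²(μ)`, so `K G` needs a meaning. The covariance of a
square-integrable law has finite trace, and `‖C v‖² ≤ ‖C‖ ⟪C v, v⟫`, so `K` is Hilbert–Schmidt
(`summable_norm_gain_sq`). Hence `∑ ε(e_j) K e_j` converges in `L²`, and `m` is an almost sure limit
of finite sums in the coefficients of the data (`exists_posteriorMean`).

Independence is a factorisation of characteristic functionals (`map_observation_residual`). It
reduces to the normal equation `inner_residual`, which makes the cross-covariance of `G` and `D`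
vanish. The variance of `D` is computed in `inner_posteriorCovariance`. Trace class comes for free,
since the posterior covariance is the covariance of a Gaussian measure. -/

theorem summable_of_pairwise_inner_eq_zero {ι F : Type*} [NormedAddCommGroup F]
    [InnerProductSpace ℝ F] [CompleteSpace F] {x : ι → F}
    (horth : Pairwise fun i j => ⟪x i, x j⟫ = 0) (hx : Summable fun i => ‖x i‖ ^ 2) :
    Summable x := by
  have hV : OrthogonalFamily ℝ (fun i => Submodule.span ℝ {x i})
      fun i => (Submodule.span ℝ {x i}).subtypeₗᵢ := by
    refine OrthogonalFamily.of_pairwise fun i j hij => ?_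
    rw [Function.onFun, Submodule.isOrtho_span]
    rintro u rfl v rfl
    exact horth hij
  exact (hV.summable_iff_norm_sq_summable
    fun i => ⟨x i, Submodule.mem_span_singleton_self _⟩).2 hx

namespace IsIsonormal

variable {E Ω : Type*} [NormedAddCommGroup E] [InnerProductSpace ℝ E] [MeasurableSpace Ω]
  {ε : E → Ω → ℝ} {Q : Measure Ω}

theorem memLp (hε : IsIsonormal ε Q) (h : E) : MemLp (ε h) 2 Q :=
  (hε.gaussian.hasGaussianLaw_eval h).memLp_two

theorem inner_toLp (hε : IsIsonormal ε Q) (h k : E) :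
    ⟪(hε.memLp h).toLp (ε h), (hε.memLp k).toLp (ε k)⟫ = ⟪h, k⟫ := by
  rw [L2.inner_def, ← hε.cov h k]
  refine integral_congr_ae ?_
  filter_upwards [(hε.memLp h).coeFn_toLp, (hε.memLp k).coeFn_toLp] with ω h1 h2
  rw [h1, h2]
  simp [mul_comm]

/-- An isonormal process, as a linear isometry into `L²(Q)`. -/
def isometry (hε : IsIsonormal ε Q) : E →ₗᵢ[ℝ] Lp ℝ 2 Q :=
  LinearMap.isometryOfInner
    { toFun := fun h => (hε.memLp h).toLp (ε h)
      map_add' := fun a b => by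
        -- Linearity is forced by the covariance: the squared `L²` norm of `ε(a + b) - ε(a) - ε(b)`
        -- expands to zero.
        rw [← sub_eq_zero, ← inner_self_eq_zero (𝕜 := ℝ)]
        simp only [inner_sub_left, inner_sub_right, inner_add_left, inner_add_right,
          hε.inner_toLp]
        ring
      map_smul' := fun c a => by
        rw [← sub_eq_zero, ← inner_self_eq_zero (𝕜 := ℝ)]
        simp only [inner_sub_left, inner_sub_right, inner_smul_left, inner_smul_right,
          hε.inner_toLp, RingHom.id_apply]
        simp }
    hε.inner_toLp

theorem coeFn_isometry (hε : IsIsonormal ε Q) (h : E) : hε.isometry h =ᵐ[Q] ε h :=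
  (hε.memLp h).coeFn_toLp

theorem map_add_ae (hε : IsIsonormal ε Q) (h k : E) :
    ∀ᵐ ω ∂Q, ε (h + k) ω = ε h ω + ε k ω := by
  filter_upwards [hε.coeFn_isometry (h + k), hε.coeFn_isometry h, hε.coeFn_isometry k,
    Lp.coeFn_add (hε.isometry h) (hε.isometry k)] with ω h1 h2 h3 h4
  rw [← h1, ← h2, ← h3, map_add, h4, Pi.add_apply]

theorem integral_exp (hε : IsIsonormal ε Q) (h : E) :
    ∫ ω, Complex.exp (ε h ω * Complex.I) ∂Q = Complex.exp (-(‖h‖ ^ 2 : ℝ) / 2) := by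
  have hg := hε.gaussian.hasGaussianLaw_eval h
  have h1 := hg.charFun_map_eq 1
  rw [charFun_apply, integral_map hg.aemeasurable (by fun_prop)] at h1
  have hvar : Var[ε h; Q] = ‖h‖ ^ 2 := by
    rw [variance_of_integral_eq_zero hg.aemeasurable (hε.mean_zero h),
      ← real_inner_self_eq_norm_sq, ← hε.cov]
    simp [sq]
  simpa [hvar, hε.mean_zero, neg_div] using h1

variable {V : Type*} [NormedAddCommGroup V] [InnerProductSpace ℝ V]

/-- The random vector `ε(h) v`, as an element of `L²(Q; V)`. -/
def smulVec (hε : IsIsonormal ε Q) (h : E) (v : V) : Lp V 2 Q :=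
  (ContinuousLinearMap.toSpanSingleton ℝ v).compLp (hε.isometry h)

theorem coeFn_smulVec (hε : IsIsonormal ε Q) (h : E) (v : V) :
    hε.smulVec h v =ᵐ[Q] fun ω => ε h ω • v := by
  filter_upwards [ContinuousLinearMap.coeFn_compLp (ContinuousLinearMap.toSpanSingleton ℝ v)
    (hε.isometry h), hε.coeFn_isometry h] with ω h1 h2
  rw [smulVec, h1, h2, ContinuousLinearMap.toSpanSingleton_apply]

theorem inner_smulVec (hε : IsIsonormal ε Q) (h k : E) (v w : V) :
    ⟪hε.smulVec h v, hε.smulVec k w⟫ = ⟪h, k⟫ * ⟪v, w⟫ := by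
  rw [L2.inner_def, ← hε.cov, ← integral_mul_const]
  refine integral_congr_ae ?_
  filter_upwards [hε.coeFn_smulVec h v, hε.coeFn_smulVec k w] with ω h1 h2
  rw [h1, h2, real_inner_smul_left, real_inner_smul_right]
  ring

variable {ι : Type*} (e : HilbertBasis ι ℝ E) (B : E →L[ℝ] V)

/-- The terms are orthogonal in `L²(Q; V)` with squared norms `‖B e_j‖²`, so the Hilbert–Schmidt
condition is what is needed. -/
theorem summable_smulVec [CompleteSpace V] (hε : IsIsonormal ε Q)
    (hB : Summable fun j => ‖B (e j)‖ ^ 2) :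
    Summable fun j => hε.smulVec (e j) (B (e j)) := by
  refine summable_of_pairwise_inner_eq_zero (fun i j hij => ?_) (hB.congr fun j => ?_)
  · simp only
    rw [hε.inner_smulVec, e.orthonormal.2 hij, zero_mul]
  · rw [← real_inner_self_eq_norm_sq, ← real_inner_self_eq_norm_sq, hε.inner_smulVec,
      real_inner_self_eq_norm_sq (e j), e.orthonormal.1 j]
    simp

/-- The random vector `∑ ε(e_j) B e_j` in `L²(Q; V)`, for a Hilbert–Schmidt operator `B`. -/
def noiseSeries (hε : IsIsonormal ε Q) : Lp V 2 Q := ∑' j, hε.smulVec (e j) (B (e j))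

variable {e B}

theorem hasSum_noiseSeries [CompleteSpace V] (hε : IsIsonormal ε Q)
    (hB : Summable fun j => ‖B (e j)‖ ^ 2) :
    HasSum (fun j => hε.smulVec (e j) (B (e j))) (hε.noiseSeries e B) :=
  (hε.summable_smulVec e B hB).hasSum

theorem coeFn_sum_smulVec (hε : IsIsonormal ε Q) (F : Finset ι) :
    (∑ j ∈ F, hε.smulVec (e j) (B (e j)) : Lp V 2 Q) =ᵐ[Q]
      fun ω => ∑ j ∈ F, ε (e j) ω • B (e j) := by
  have h1 := Lp.coeFn_finsetSum F fun j => hε.smulVec (e j) (B (e j))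
  have h2 : ∀ᵐ ω ∂Q, ∀ j ∈ F, hε.smulVec (e j) (B (e j)) ω = ε (e j) ω • B (e j) :=
    (ae_ball_iff F.countable_toSet).2 fun j _ => hε.coeFn_smulVec (e j) (B (e j))
  filter_upwards [h1, h2] with ω h1 h2
  rw [h1, Finset.sum_apply]
  exact Finset.sum_congr rfl h2

theorem tendsto_eLpNorm_noiseSeries [CompleteSpace V] (hε : IsIsonormal ε Q)
    (hB : Summable fun j => ‖B (e j)‖ ^ 2) :
    Tendsto (fun F : Finset ι => eLpNorm (fun ω =>
      hε.noiseSeries e B ω - ∑ j ∈ F, ε (e j) ω • B (e j)) 2 Q) atTop (𝓝 0) := by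
  have h := (Lp.tendsto_Lp_iff_tendsto_eLpNorm' _ _).1 (hε.hasSum_noiseSeries hB)
  refine h.congr fun F => ?_
  rw [eLpNorm_sub_comm]
  refine eLpNorm_congr_ae ?_
  filter_upwards [hε.coeFn_sum_smulVec (e := e) (B := B) F] with ω hω
  rw [Pi.sub_apply, hω]

/-- Convergence in `L²` implies almost sure convergence along a subsequence of partial sums; this
lets the posterior mean be built as a pointwise limit. -/
theorem exists_seq_tendsto_noiseSeries [CompleteSpace V] [Countable ι] (hε : IsIsonormal ε Q)
    (hB : Summable fun j => ‖B (e j)‖ ^ 2) :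
    ∃ ns : ℕ → Finset ι, Tendsto ns atTop atTop ∧ ∀ᵐ ω ∂Q,
      Tendsto (fun n => ∑ j ∈ ns n, ε (e j) ω • B (e j)) atTop (𝓝 (hε.noiseSeries e B ω)) := by
  obtain ⟨ns, hns, hlim⟩ :=
    (tendstoInMeasure_of_tendsto_Lp (hε.hasSum_noiseSeries hB)).exists_seq_tendsto_ae'
  refine ⟨ns, hns, ?_⟩
  have h2 : ∀ᵐ ω ∂Q, ∀ n, (∑ j ∈ ns n, hε.smulVec (e j) (B (e j)) : Lp V 2 Q) ω =
      ∑ j ∈ ns n, ε (e j) ω • B (e j) :=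
    ae_all_iff.2 fun n => hε.coeFn_sum_smulVec (ns n)
  filter_upwards [hlim, h2] with ω h1 h2
  exact h1.congr h2

/-- A functional of the noise series is the value of the process at the vector representing the
functional. -/
theorem map_noiseSeries [CompleteSpace V] (hε : IsIsonormal ε Q)
    (hB : Summable fun j => ‖B (e j)‖ ^ 2) (L : V →L[ℝ] ℝ) (h : E)
    (hL : ∀ x, L (B x) = ⟪h, x⟫) : ∀ᵐ ω ∂Q, L (hε.noiseSeries e B ω) = ε h ω := by
  -- Both sides are sums in `L²(Q)` of the same series `∑ ⟪h, e_j⟫ ε(e_j)`, so they agree by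
  -- uniqueness of the sum.
  have h1 : HasSum (fun j => e.repr h j • hε.isometry (e j)) (hε.isometry h) := by
    simpa using (e.hasSum_repr h).mapL hε.isometry.toContinuousLinearMap
  have h2 := (hε.hasSum_noiseSeries hB).mapL (L.compLpL 2 Q)
  have h3 : ∀ j, L.compLpL 2 Q (hε.smulVec (e j) (B (e j))) = e.repr h j • hε.isometry (e j) := by
    intro j
    refine Lp.ext ?_
    filter_upwards [L.coeFn_compLp (hε.smulVec (e j) (B (e j))), hε.coeFn_smulVec (e j) (B (e j)),
      hε.coeFn_isometry (e j), Lp.coeFn_smul (e.repr h j) (hε.isometry (e j))] with ω a b c d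
    rw [d, Pi.smul_apply, c]
    change (L.compLp _) ω = _
    rw [a, b, map_smul, hL, e.repr_apply_apply, real_inner_comm, smul_eq_mul, smul_eq_mul, mul_comm]
  have h4 := h2.unique (h1.congr_fun h3)
  filter_upwards [L.coeFn_compLp (hε.noiseSeries e B), hε.coeFn_isometry h] with ω a b
  rw [← b, ← h4, ← a]
  rfl

end IsIsonormal

/-! ### Covariance operators -/

namespace HasCovariance

variable {U : Type*} [NormedAddCommGroup U] [InnerProductSpace ℝ U]
  [MeasurableSpace U] [BorelSpace U] {ν : Measure U} {C : U →L[ℝ] U}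

theorem inner_comm (hC : HasCovariance ν C) (u v : U) : ⟪C u, v⟫ = ⟪u, C v⟫ := by
  rw [← hC.2, covarianceBilin_comm, hC.2, real_inner_comm]

theorem inner_self_nonneg (hC : HasCovariance ν C) (u : U) : 0 ≤ ⟪C u, u⟫ := by
  rw [← hC.2]; exact covarianceBilin_self_nonneg u

theorem isPositive (hC : HasCovariance ν C) : C.IsPositive := by
  rw [ContinuousLinearMap.isPositive_iff]
  exact ⟨hC.inner_comm, hC.inner_self_nonneg⟩

/-- Cauchy–Schwarz for the form `⟪C ·, ·⟫` at `C u` and `u`, in discriminant form. It turns trace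
bounds into Hilbert–Schmidt bounds. -/
theorem norm_apply_sq_le (hC : HasCovariance ν C) (u : U) : ‖C u‖ ^ 2 ≤ ‖C‖ * ⟪C u, u⟫ := by
  have hquad : ∀ t : ℝ, 0 ≤ ⟪C (C u), C u⟫ * (t * t) + 2 * ‖C u‖ ^ 2 * t + ⟪C u, u⟫ := by
    intro t
    have h := hC.inner_self_nonneg (t • C u + u)
    simp only [map_add, map_smul, inner_add_left, inner_add_right, real_inner_smul_left,
      real_inner_smul_right] at h
    rw [hC.inner_comm (C u) u, real_inner_self_eq_norm_sq] at h
    linarith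
  have hdisc := discrim_le_zero hquad
  have h2 : ⟪C (C u), C u⟫ ≤ ‖C‖ * ‖C u‖ ^ 2 := by
    refine (real_inner_le_norm _ _).trans ?_
    rw [sq, ← mul_assoc]
    gcongr
    exact C.le_opNorm _
  rw [discrim] at hdisc
  have h0 := hC.inner_self_nonneg u
  rcases (sq_nonneg ‖C u‖).eq_or_lt with h | h
  · rw [← h]; positivity
  · have h3 := mul_le_mul_of_nonneg_right h2 h0
    nlinarith

variable [CompleteSpace U]

/-- Each term is the integral of `⟪e_j, B*(z - m)⟫²`, so Bessel's inequality bounds the partial sums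
by the integral of `‖B*(z - m)‖²`. The operator `B` is the identity for the trace of `C`, and `T* (T
C T* + I)⁻¹` for the gain. -/
theorem summable_inner [IsFiniteMeasure ν] (hC : HasCovariance ν C) {E ι : Type*}
    [NormedAddCommGroup E] [InnerProductSpace ℝ E] [CompleteSpace E] {e : ι → E}
    (he : Orthonormal ℝ e) (B : E →L[ℝ] U) :
    Summable fun j => ⟪C (B (e j)), B (e j)⟫ := by
  set m : U := ∫ x, id x ∂ν with hm
  have hL : MemLp (fun z => B.adjoint (z - m)) 2 ν :=
    B.adjoint.comp_memLp' (hC.1.sub (memLp_const m))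
  have hLj : ∀ j, MemLp (fun z => ⟪e j, B.adjoint (z - m)⟫) 2 ν := fun j => hL.const_inner (e j)
  refine summable_of_sum_le (c := ∫ z, ‖B.adjoint (z - m)‖ ^ 2 ∂ν)
    (fun j => hC.inner_self_nonneg _) fun F => ?_
  have hj : ∀ j, ⟪C (B (e j)), B (e j)⟫ = ∫ z, ‖⟪e j, B.adjoint (z - m)⟫‖ ^ 2 ∂ν := by
    intro j
    rw [← hC.2, covarianceBilin_apply hC.1]
    refine integral_congr_ae (Eventually.of_forall fun z => ?_)
    simp only
    rw [ContinuousLinearMap.adjoint_inner_right, Real.norm_eq_abs, sq_abs, sq]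
  simp_rw [hj]
  rw [← integral_finsetSum _ fun j _ => (hLj j).norm.integrable_sq]
  exact integral_mono (integrable_finsetSum _ fun j _ => (hLj j).norm.integrable_sq)
    hL.norm.integrable_sq fun z => he.sum_inner_products_le _

theorem isTraceClass [IsFiniteMeasure ν] (hC : HasCovariance ν C) : IsTraceClass C := by
  refine ⟨C, hC.isPositive, ?_, fun w b => ?_⟩
  · rw [hC.isPositive.isSelfAdjoint.adjoint_eq]
  · exact hC.summable_inner b.orthonormal (ContinuousLinearMap.id ℝ U)

variable {E : Type*} [NormedAddCommGroup E] [InnerProductSpace ℝ E] [CompleteSpace E]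
  (T : U →L[ℝ] E)

/-- Coercivity: positivity of `C` makes the quadratic form at least `‖x‖²`. -/
theorem isUnit_dataCovariance (hC : HasCovariance ν C) : IsUnit (dataCovariance C T) := by
  refine ContinuousLinearMap.isUnit_of_forall_le_norm_inner_map _ (c := 1) one_pos fun x => ?_
  have h : ⟪dataCovariance C T x, x⟫ = ⟪C (T.adjoint x), T.adjoint x⟫ + ‖x‖ ^ 2 := by
    rw [ContinuousLinearMap.adjoint_inner_right, ← real_inner_self_eq_norm_sq, ← inner_add_left]
    rfl
  rw [h, NNReal.coe_one, mul_one]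
  exact (le_add_of_nonneg_left (hC.inner_self_nonneg _)).trans (le_abs_self _)

end HasCovariance

/-! ### Algebra of the gain operator -/

section Gain

variable {U E : Type*} [NormedAddCommGroup U] [InnerProductSpace ℝ U] [CompleteSpace U]
  [NormedAddCommGroup E] [InnerProductSpace ℝ E] [CompleteSpace E]
  (C : U →L[ℝ] U) (T : U →L[ℝ] E)

/-- The operator `C T* (T C T* + I)⁻¹` that maps the data to the posterior mean. -/
def gain : E →L[ℝ] U := C ∘L T.adjoint ∘L Ring.inverse (dataCovariance C T)

/-- The operator `(T C T* + I)⁻¹ T C`, the adjoint of the gain. -/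
def cogain : U →L[ℝ] E := Ring.inverse (dataCovariance C T) ∘L T ∘L C

variable {C} [MeasurableSpace U] [BorelSpace U] {ν : Measure U}

theorem inner_conjugate_comm (hC : HasCovariance ν C) (x y : E) :
    ⟪T (C (T.adjoint x)), y⟫ = ⟪x, T (C (T.adjoint y))⟫ := by
  rw [← ContinuousLinearMap.adjoint_inner_right, hC.inner_comm,
    ContinuousLinearMap.adjoint_inner_left]

theorem dataCovariance_cogain (hC : HasCovariance ν C) (u : U) :
    T (C (T.adjoint (cogain C T u))) + cogain C T u = T (C u) := by
  have h := Ring.mul_inverse_cancel _ (hC.isUnit_dataCovariance T)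
  exact DFunLike.congr_fun h (T (C u))

/-- Substituting `x = (T C T* + I) y` and `T C u = (T C T* + I) (cogain C T u)` leaves only the
symmetry of `T C T* + I`; the inverse itself never has to be transposed. -/
theorem inner_gain (hC : HasCovariance ν C) (x : E) (u : U) :
    ⟪u, gain C T x⟫ = ⟪cogain C T u, x⟫ := by
  have h := Ring.mul_inverse_cancel _ (hC.isUnit_dataCovariance T)
  set y := Ring.inverse (dataCovariance C T) x with hy
  have hx : T (C (T.adjoint y)) + y = x := DFunLike.congr_fun h x
  have hu := dataCovariance_cogain T hC u
  have hg : gain C T x = C (T.adjoint y) := rfl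
  rw [hg, ← hC.inner_comm, ContinuousLinearMap.adjoint_inner_right, ← hu, ← hx, inner_add_left,
    inner_add_right, inner_conjugate_comm T hC]

/-- The normal equation. The left side is the prior contribution to the covariance between data and
residual; the right side cancels the noise contribution `-⟪h, cogain C T u⟫`. -/
theorem inner_residual (hC : HasCovariance ν C) (h : E) (u : U) :
    ⟪C (T.adjoint h), u - T.adjoint (cogain C T u)⟫ = ⟪h, cogain C T u⟫ := by
  rw [hC.inner_comm, ContinuousLinearMap.adjoint_inner_left, map_sub, map_sub,
    ← dataCovariance_cogain T hC u, add_sub_cancel_left]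

/-- The left side is the variance of the residual in direction `u`, split into its prior and noise
parts. -/
theorem inner_posteriorCovariance (hC : HasCovariance ν C) (u : U) :
    ⟪C (u - T.adjoint (cogain C T u)), u - T.adjoint (cogain C T u)⟫ + ‖cogain C T u‖ ^ 2 =
      ⟪posteriorCovariance C T u, u⟫ := by
  have h1 : posteriorCovariance C T u = C (u - T.adjoint (cogain C T u)) := by
    rw [map_sub]; rfl
  have h2 := inner_residual T hC (cogain C T u) u
  rw [hC.inner_comm, real_inner_comm] at h2
  rw [h1, inner_sub_right, h2, real_inner_self_eq_norm_sq, sub_add_cancel]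

theorem inner_posteriorCovariance_comm (hC : HasCovariance ν C) (u v : U) :
    ⟪posteriorCovariance C T u, v⟫ = ⟪posteriorCovariance C T v, u⟫ := by
  have h1 : ∀ u v, ⟪posteriorCovariance C T u, v⟫ =
      ⟪C u, v⟫ - ⟪cogain C T u, T (C v)⟫ := by
    intro u v
    have : posteriorCovariance C T u = C u - C (T.adjoint (cogain C T u)) := rfl
    rw [this, inner_sub_left, hC.inner_comm (T.adjoint _),
      ContinuousLinearMap.adjoint_inner_left]
  rw [h1, h1, hC.inner_comm u v, real_inner_comm, ← dataCovariance_cogain T hC u,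
    ← dataCovariance_cogain T hC v, inner_add_right, inner_add_right,
    real_inner_comm (cogain C T u) (cogain C T v), ← inner_conjugate_comm T hC,
    real_inner_comm (cogain C T v)]

/-- The gain is Hilbert–Schmidt, hence can be applied to white noise. -/
theorem summable_norm_gain_sq [IsFiniteMeasure ν] (hC : HasCovariance ν C) {ι : Type*}
    (e : HilbertBasis ι ℝ E) : Summable fun j => ‖gain C T (e j)‖ ^ 2 :=
  Summable.of_nonneg_of_le (fun _ => sq_nonneg _) (fun _ => hC.norm_apply_sq_le _)
    ((hC.summable_inner e.orthonormal
      (T.adjoint ∘L Ring.inverse (dataCovariance C T))).mul_left ‖C‖)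

end Gain

/-! ### The noise as a random element of the Hilbert scale -/

namespace HilbertScale

variable {J : Set ℕ+} {s : ℝ}

theorem ext_coeff {t : ℝ} {z w : HilbertScale J t} (h : ∀ j, coeff z j = coeff w j) : z = w :=
  Subtype.ext (funext h)

/-- The element of `Z_t` with given coefficients. -/
def ofMem {t : ℝ} (w : J → ℝ) (hw : w ∈ scaleSubmodule J t) : HilbertScale J t :=
  (⟨w, hw⟩ : scaleSubmodule J t)

/-- The duality pairing of `Z_{-s}` with an element `w` of `Z_s`. -/
def pairing (w : HilbertScale J s) : HilbertScale J (-s) →L[ℝ] ℝ :=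
  innerSL ℝ (toL2 w) ∘L (isometryL2.toLinearIsometry.toContinuousLinearMap)

theorem hasSum_pairing (w : HilbertScale J s) (z : HilbertScale J (-s)) :
    HasSum (fun j => coeff z j * coeff w j) (pairing w z) := by
  have h := lp.hasSum_inner (𝕜 := ℝ) (toL2 w) (toL2 z)
  refine h.congr_fun fun j => ?_
  change _ = inner ℝ (((j : ℕ+) : ℝ) ^ s * coeff w j) (((j : ℕ+) : ℝ) ^ (-s) * coeff z j)
  have h0 : (0 : ℝ) ≤ ((j : ℕ+) : ℝ) := by positivity
  have h1 := (weight_pos s j).ne'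
  rw [Real.rpow_neg h0]
  simp only [RCLike.inner_apply, conj_trivial]
  field_simp

theorem ofCoeff_eq {t : ℝ} {w : J → ℝ} (hw : w ∈ scaleSubmodule J t) :
    ofCoeff t w = ofMem w hw := dif_pos hw

open Classical in
theorem single_mem (t : ℝ) (k : J) : (Pi.single k 1 : J → ℝ) ∈ scaleSubmodule J t :=
  summable_of_ne_finset_zero (s := {k}) fun j hj => by
    rw [Pi.single_eq_of_ne (by simpa using hj)]; simp

open Classical in
/-- The basis vector `e_k` as an element of `Z_t`. -/
def basisVec (t : ℝ) (k : J) : HilbertScale J t := ofMem (Pi.single k 1) (single_mem t k)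

open Classical in
theorem coeff_basisVec (t : ℝ) (k j : J) :
    coeff (basisVec t k) j = (Pi.single k 1 : J → ℝ) j := rfl

theorem pairing_basisVec (k : J) (z : HilbertScale J (-s)) :
    pairing (basisVec s k) z = coeff z k := by
  refine (hasSum_pairing _ z).unique ?_
  convert hasSum_single k fun j hj => ?_ using 1
  · rw [coeff_basisVec, Pi.single_eq_same, mul_one]
  · rw [coeff_basisVec, Pi.single_eq_of_ne hj, mul_zero]

theorem measurable_coeff (k : J) : Measurable fun z : HilbertScale J (-s) => coeff z k := by
  simp_rw [← pairing_basisVec]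
  exact (pairing _).measurable

end HilbertScale

open HilbertScale

section Realisation

variable {E : Type*} [NormedAddCommGroup E] [InnerProductSpace ℝ E]
  {J : Set ℕ+} {e : HilbertBasis J ℝ E} {s : ℝ}
  (hs : Summable fun j : J => ((j : ℕ+) : ℝ) ^ (-2 * s))

theorem coeff_toScale (x : E) (j : J) : coeff (toScale e hs x) j = e.repr x j := rfl

theorem pairing_toScale (w : HilbertScale J s) (h : E) (hw : ∀ j, coeff w j = e.repr h j) (x : E) :
    pairing w (toScale e hs x) = ⟪h, x⟫ := by
  refine (hasSum_pairing w _).unique ((e.hasSum_inner_mul_inner h x).congr_fun fun j => ?_)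
  rw [hw, coeff_toScale, e.repr_apply_apply, e.repr_apply_apply, mul_comm,
    real_inner_comm h (e j)]

theorem coeff_basisVec_eq_repr (k j : J) : coeff (basisVec s k) j = e.repr (e k) j := by
  classical
  rw [e.repr_self, lp.single_apply, coeff_basisVec]

theorem norm_toScale_sq (j : J) :
    ‖toScale e hs (e j)‖ ^ 2 = ((j : ℕ+) : ℝ) ^ (-2 * s) := by
  classical
  rw [← real_inner_self_eq_norm_sq, inner_eq, tsum_eq_single j]
  · rw [coeff_toScale, e.repr_self]; simp
  · intro k hk
    rw [coeff_toScale, e.repr_self, lp.single_apply_ne _ _ _ hk]; simp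

theorem summable_norm_toScale_sq : Summable fun j => ‖toScale e hs (e j)‖ ^ 2 := by
  simpa only [norm_toScale_sq hs] using hs

variable {Ω : Type*} [MeasurableSpace Ω] {Q : Measure Ω} {ε : E → Ω → ℝ}

theorem coeff_noiseSeries_ae (hε : IsIsonormal ε Q) :
    ∀ᵐ ω ∂Q, ∀ k : J, coeff (hε.noiseSeries e (toScale e hs) ω) k = ε (e k) ω := by
  refine ae_all_iff.2 fun k => ?_
  simp_rw [← pairing_basisVec]
  exact hε.map_noiseSeries (summable_norm_toScale_sq hs) _ (e k)
    (pairing_toScale hs _ _ (coeff_basisVec_eq_repr k))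

theorem realisation_ae_eq (hε : IsIsonormal ε Q) :
    realisation e s ε =ᵐ[Q] hε.noiseSeries e (toScale e hs) := by
  filter_upwards [coeff_noiseSeries_ae hs hε] with ω hω
  -- Almost surely these are the coefficients of an actual element of `Z_{-s}`, so the default value
  -- `0` of `ofCoeff` occurs only on a null set.
  have hmem : (fun j => ε (e j) ω) ∈ scaleSubmodule J (-s) := by
    rw [← funext hω]
    exact (hε.noiseSeries e (toScale e hs) ω).2
  rw [realisation, ofCoeff_eq hmem]
  exact ext_coeff fun j => (hω j).symm

theorem aemeasurable_realisation (hs : Summable fun j : J => ((j : ℕ+) : ℝ) ^ (-2 * s))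
    (hε : IsIsonormal ε Q) : AEMeasurable (realisation e s ε) Q :=
  (Lp.aestronglyMeasurable (hε.noiseSeries e (toScale e hs))).aemeasurable.congr
    (realisation_ae_eq hs hε).symm

theorem tendsto_eLpNorm_realisation (hε : IsIsonormal ε Q) :
    Tendsto (fun F : Finset J => eLpNorm (fun ω =>
      realisation e s ε ω - ∑ j ∈ F, ε (e j) ω • toScale e hs (e j)) 2 Q) atTop (𝓝 0) := by
  refine (hε.tendsto_eLpNorm_noiseSeries (e := e) (summable_norm_toScale_sq hs)).congr fun F =>
    eLpNorm_congr_ae ?_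
  filter_upwards [realisation_ae_eq hs hε] with ω hω
  rw [hω]

theorem hasSum_coeff_realisation (hs : Summable fun j : J => ((j : ℕ+) : ℝ) ^ (-2 * s))
    (hε : IsIsonormal ε Q) (h : E)
    (hh : (fun j => e.repr h j) ∈ scaleSubmodule J s) :
    ∀ᵐ ω ∂Q, HasSum (fun j : J => (realisation e s ε ω).coeff j * e.repr h j) (ε h ω) := by
  filter_upwards [realisation_ae_eq hs hε, hε.map_noiseSeries (summable_norm_toScale_sq (e := e) hs) _ h
    (pairing_toScale hs (ofMem _ hh) h fun _ => rfl)] with ω h1 h2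
  rw [h1, ← h2]
  exact hasSum_pairing (ofMem _ hh) _

end Realisation

/-! ### The posterior distribution -/

section Shift

variable {α V : Type*} [MeasurableSpace α] [NormedAddCommGroup V] [MeasurableSpace V]
  [BorelSpace V] [SecondCountableTopology V]

/-- The kernel sending `z` to the translate of `N` by `m z`. -/
def shiftKernel (m : α → V) (hm : Measurable m) (N : Measure V) [SFinite N] : Kernel α V :=
  (Kernel.deterministic m hm ×ₖ Kernel.const α N).map fun p => p.1 + p.2

theorem shiftKernel_apply (m : α → V) (hm : Measurable m) (N : Measure V) [SFinite N] (z : α) :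
    shiftKernel m hm N z = N.map fun x => m z + x := by
  rw [shiftKernel, Kernel.map_apply _ (by fun_prop), Kernel.prod_apply, Kernel.deterministic_apply,
    Kernel.const_apply, Measure.dirac_prod, Measure.map_map (by fun_prop) (by fun_prop)]
  rfl

/-- A kernel of translates amounts to adding an independent variable. It serves both for the
likelihood and for the posterior kernel. -/
theorem compProd_eq_map_prod (κ : Kernel α V) [IsSFiniteKernel κ] (m : α → V) (hm : Measurable m)
    (N : Measure V) [SFinite N] (hκ : ∀ z, κ z = N.map fun x => m z + x)
    (ρ : Measure α) [SFinite ρ] :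
    ρ ⊗ₘ κ = (ρ.prod N).map fun p => (p.1, m p.1 + p.2) := by
  have hmeas : Measurable fun p : α × V => (p.1, m p.1 + p.2) := by fun_prop
  refine Measure.ext_of_lintegral _ fun F hF => ?_
  rw [Measure.lintegral_compProd hF, lintegral_map hF hmeas,
    lintegral_prod (fun p => F (p.1, m p.1 + p.2)) (hF.comp hmeas).aemeasurable]
  refine lintegral_congr fun z => ?_
  rw [hκ, lintegral_map (by fun_prop) (by fun_prop)]

end Shift

theorem ae_prod_of_ae_snd {α β : Type*} [MeasurableSpace α] [MeasurableSpace β] {ρ : Measure α}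
    {Q : Measure β} {q : β → Prop} (h : ∀ᵐ ω ∂Q, q ω) : ∀ᵐ p ∂ρ.prod Q, q p.2 :=
  Measure.quasiMeasurePreserving_snd.ae h

section Posterior

set_option linter.unusedSectionVars false

open HilbertScale

variable {U E Ω : Type*}
  [NormedAddCommGroup U] [InnerProductSpace ℝ U] [CompleteSpace U]
  [SecondCountableTopology U] [MeasurableSpace U] [BorelSpace U]
  [NormedAddCommGroup E] [InnerProductSpace ℝ E] [CompleteSpace E]
  {C : U →L[ℝ] U} {prior : Measure U} [IsGaussian prior]
  [MeasurableSpace Ω] {Q : Measure Ω} [IsProbabilityMeasure Q] {ε : E → Ω → ℝ}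

theorem integral_exp_inner_prior (hmean : ∫ u, u ∂prior = 0) (hC : HasCovariance prior C) (u : U) :
    ∫ x, Complex.exp (⟪u, x⟫ * Complex.I) ∂prior = Complex.exp (-(⟪C u, u⟫ : ℝ) / 2) := by
  have h := IsGaussian.charFun_eq' (μ := prior) u
  rw [charFun_apply, hC.2] at h
  simp_rw [real_inner_comm u] at h
  rw [real_inner_comm]
  simpa [hmean, neg_div] using h

theorem integral_exp_prod (hmean : ∫ u, u ∂prior = 0) (hC : HasCovariance prior C)
    (hε : IsIsonormal ε Q) (u : U) (h : E) :
    ∫ p, Complex.exp ((⟪u, p.1⟫ + ε h p.2 : ℝ) * Complex.I) ∂prior.prod Q =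
      Complex.exp (-(⟪C u, u⟫ + ‖h‖ ^ 2 : ℝ) / 2) := by
  have := integral_prod_mul (μ := prior) (ν := Q) (fun x => Complex.exp (⟪u, x⟫ * Complex.I))
    (fun ω => Complex.exp (ε h ω * Complex.I))
  rw [integral_exp_inner_prior hmean hC, hε.integral_exp, ← Complex.exp_add] at this
  simp only [← Complex.exp_add, ← add_mul] at this
  simp only [Complex.ofReal_add]
  refine this.trans ?_
  congr 1
  ring

variable {J : Set ℕ+} (e : HilbertBasis J ℝ E) {s : ℝ}
  (hs : Summable fun j : J => ((j : ℕ+) : ℝ) ^ (-2 * s)) (T : U →L[ℝ] E) (hε : IsIsonormal ε Q)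

/-- The data `T u + ε̃`, as a function on the product of the parameter space and the space
carrying the noise. -/
def observation (p : U × Ω) : HilbertScale J (-s) :=
  toScale e hs (T p.1) + hε.noiseSeries e (toScale e hs) p.2

theorem measurable_observation : Measurable (observation e hs T hε) :=
  ((toScale e hs ∘L T).measurable.comp measurable_fst).add
    ((Lp.stronglyMeasurable _).measurable.comp measurable_snd)

/-- The posterior mean: a measurable function of the data that extends the gain operator. -/
theorem exists_posteriorMean (hC : HasCovariance prior C) :
    ∃ m : HilbertScale J (-s) → U, Measurable m ∧ ∀ᵐ p ∂prior.prod Q,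
      m (observation e hs T hε p) = gain C T (T p.1) + hε.noiseSeries e (gain C T) p.2 := by
  obtain ⟨ns, hns, hlim⟩ := hε.exists_seq_tendsto_noiseSeries (summable_norm_gain_sq T hC e)
  set φ : ℕ → HilbertScale J (-s) → U := fun n z => ∑ j ∈ ns n, coeff z j • gain C T (e j) with hφ
  have hφm : ∀ n, Measurable (φ n) := fun n =>
    Finset.measurable_fun_sum _ fun j _ => (measurable_coeff j).smul_const _
  have hconv : ∀ᵐ p ∂prior.prod Q, Tendsto (fun n => φ n (observation e hs T hε p)) atTop
      (𝓝 (gain C T (T p.1) + hε.noiseSeries e (gain C T) p.2)) := by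
    filter_upwards [ae_prod_of_ae_snd hlim,
      ae_prod_of_ae_snd (coeff_noiseSeries_ae (e := e) hs hε)] with p h1 h2
    -- The signal part converges along any exhausting sequence of finite sets; only the noise part
    -- dictates the choice of `ns`.
    have h3 : Tendsto (fun n => ∑ j ∈ ns n, e.repr (T p.1) j • gain C T (e j)) atTop
        (𝓝 (gain C T (T p.1))) := by
      have := (e.hasSum_repr (T p.1)).mapL (gain C T)
      simp only [map_smul] at this
      exact (show Tendsto (fun F : Finset J => ∑ j ∈ F, e.repr (T p.1) j • gain C T (e j)) atTop _
        from this).comp hns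
    refine (h3.add h1).congr fun n => ?_
    rw [← Finset.sum_add_distrib]
    refine Finset.sum_congr rfl fun j _ => ?_
    rw [observation, map_add, Pi.add_apply, coeff_toScale, h2, add_smul]
  have hG := measurable_observation e hs T hε
  -- The limit is taken under the law of the data, so that `m` is a function of the data alone.
  obtain ⟨m, hm, hmlim⟩ := measurable_limit_of_tendsto_metrizable_ae (L := atTop)
    (μ := (prior.prod Q).map (observation e hs T hε)) (fun n => (hφm n).aemeasurable) (by
      rw [ae_map_iff hG.aemeasurable (measurableSet_exists_tendsto hφm)]
      filter_upwards [hconv] with p hp using ⟨_, hp⟩)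
  refine ⟨m, hm, ?_⟩
  filter_upwards [hconv, ae_of_ae_map hG.aemeasurable hmlim] with p h1 h2
  exact tendsto_nhds_unique h2 h1

/-- By Riesz, `L` restricted to `E` is the inner product with some `h`, and on the noise it becomes
`ε h`. -/
theorem map_observation_ae (L : HilbertScale J (-s) →L[ℝ] ℝ) :
    ∃ h : E, ∀ᵐ p ∂prior.prod Q,
      L (observation e hs T hε p) = ⟪T.adjoint h, p.1⟫ + ε h p.2 := by
  set h := (InnerProductSpace.toDual ℝ E).symm (L ∘L toScale e hs) with hh
  have hL : ∀ x, L (toScale e hs x) = ⟪h, x⟫ := fun x => by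
    rw [hh, InnerProductSpace.toDual_symm_apply]; rfl
  refine ⟨h, ?_⟩
  filter_upwards [ae_prod_of_ae_snd
    (hε.map_noiseSeries (summable_norm_toScale_sq hs) L h hL)] with p hp
  rw [observation, map_add, hp, hL, ContinuousLinearMap.adjoint_inner_left]

variable {m : HilbertScale J (-s) → U}

theorem inner_residual_ae (hC : HasCovariance prior C)
    (hm : ∀ᵐ p ∂prior.prod Q,
      m (observation e hs T hε p) = gain C T (T p.1) + hε.noiseSeries e (gain C T) p.2) (u : U) :
    ∀ᵐ p ∂prior.prod Q, ⟪u, p.1 - m (observation e hs T hε p)⟫ =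
      ⟪u - T.adjoint (cogain C T u), p.1⟫ + ε (-cogain C T u) p.2 := by
  filter_upwards [hm, ae_prod_of_ae_snd (hε.map_noiseSeries (summable_norm_gain_sq T hC e)
    (-innerSL ℝ u) (-cogain C T u) fun x => by
      simp [inner_gain T hC])] with p h1 h2
  rw [← h2, h1, inner_sub_right, inner_add_right, inner_gain T hC, inner_sub_left,
    ContinuousLinearMap.adjoint_inner_left]
  simp only [neg_apply, innerSL_apply_apply]
  ring

/-- The law of the difference of the parameter and its posterior mean. -/
def residualLaw (prior : Measure U) (m : HilbertScale J (-s) → U) : Measure U :=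
  (prior.prod Q).map fun p => p.1 - m (observation e hs T hε p)

theorem measurable_residual (hm : Measurable m) :
    Measurable fun p => p.1 - m (observation e hs T hε p) :=
  measurable_fst.sub (hm.comp (measurable_observation e hs T hε))

theorem charFun_residualLaw (hmean : ∫ u, u ∂prior = 0) (hC : HasCovariance prior C)
    (hmm : Measurable m)
    (hm : ∀ᵐ p ∂prior.prod Q,
      m (observation e hs T hε p) = gain C T (T p.1) + hε.noiseSeries e (gain C T) p.2) (u : U) :
    charFun (residualLaw e hs T hε prior m) u =
      Complex.exp (-(⟪posteriorCovariance C T u, u⟫ : ℝ) / 2) := by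
  rw [charFun_apply, residualLaw, integral_map (measurable_residual e hs T hε hmm).aemeasurable
    (by fun_prop), ← inner_posteriorCovariance T hC, ← norm_neg (cogain C T u),
    ← integral_exp_prod hmean hC hε]
  refine integral_congr_ae ?_
  filter_upwards [inner_residual_ae e hs T hε hC hm u] with p hp
  rw [real_inner_comm, hp]

theorem isGaussian_residualLaw (hmean : ∫ u, u ∂prior = 0) (hC : HasCovariance prior C)
    (hmm : Measurable m)
    (hm : ∀ᵐ p ∂prior.prod Q,
      m (observation e hs T hε p) = gain C T (T p.1) + hε.noiseSeries e (gain C T) p.2) :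
    IsGaussian (residualLaw e hs T hε prior m) ∧
      HasCovariance (residualLaw e hs T hε prior m) (posteriorCovariance C T) := by
  have hprob : IsProbabilityMeasure (residualLaw e hs T hε prior m) :=
    Measure.isProbabilityMeasure_map (measurable_residual e hs T hε hmm).aemeasurable
  set B : U →L[ℝ] U →L[ℝ] ℝ := innerSL ℝ ∘L posteriorCovariance C T with hB
  have hBapp : ∀ u v, B u v = ⟪posteriorCovariance C T u, v⟫ := fun u v => rfl
  have hpos : B.toBilinForm.IsPosSemidef := by
    refine ⟨⟨fun u v => inner_posteriorCovariance_comm T hC u v⟩, ⟨fun u => ?_⟩⟩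
    change 0 ≤ ⟪posteriorCovariance C T u, u⟫
    rw [← inner_posteriorCovariance T hC]
    exact add_nonneg (hC.inner_self_nonneg _) (sq_nonneg _)
  have hchar : ∀ u, charFun (residualLaw e hs T hε prior m) u =
      Complex.exp ((⟪u, (0 : U)⟫ : ℝ) * Complex.I - (B u u : ℝ) / 2) := by
    intro u
    rw [charFun_residualLaw e hs T hε hmean hC hmm hm, hBapp, inner_zero_right]
    simp [neg_div]
  have hG : IsGaussian (residualLaw e hs T hε prior m) :=
    isGaussian_iff_gaussian_charFun.2 ⟨0, B, hpos, hchar⟩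
  refine ⟨hG, IsGaussian.memLp_two_id, fun u v => ?_⟩
  rw [← (gaussian_charFun_congr 0 B hpos hchar).2, hBapp]

/-- Independence of data and residual. A functional of the pair is almost surely `⟪v, f⟫ + ε(k)` for
some `v` and `k`, so its characteristic function is explicit, and factorisation is an identity of
quadratic forms. -/
theorem map_observation_residual (hmean : ∫ u, u ∂prior = 0) (hC : HasCovariance prior C)
    (hmm : Measurable m)
    (hm : ∀ᵐ p ∂prior.prod Q,
      m (observation e hs T hε p) = gain C T (T p.1) + hε.noiseSeries e (gain C T) p.2) :
    (prior.prod Q).map (fun p => (observation e hs T hε p, p.1 - m (observation e hs T hε p))) =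
      ((prior.prod Q).map (observation e hs T hε)).prod (residualLaw e hs T hε prior m) := by
  have hGm := measurable_observation e hs T hε
  have hDm := measurable_residual e hs T hε hmm
  have hprob : IsProbabilityMeasure (residualLaw e hs T hε prior m) :=
    Measure.isProbabilityMeasure_map hDm.aemeasurable
  have hprob' : IsProbabilityMeasure ((prior.prod Q).map (observation e hs T hε)) :=
    Measure.isProbabilityMeasure_map hGm.aemeasurable
  refine charFunDual_eq_prod_iff.1 fun L => ?_
  set u := (InnerProductSpace.toDual ℝ U).symm (L ∘L ContinuousLinearMap.inr ℝ _ _) with hu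
  obtain ⟨h, hh⟩ := map_observation_ae (prior := prior) e hs T hε
    (L ∘L ContinuousLinearMap.inl ℝ _ _)
  have hL2 : ∀ x, (L ∘L ContinuousLinearMap.inr ℝ _ _) x = ⟪u, x⟫ := fun x => by
    rw [hu, InnerProductSpace.toDual_symm_apply]
  have hD := inner_residual_ae e hs T hε hC hm u
  have hdual : charFunDual (residualLaw e hs T hε prior m)
      (L ∘L ContinuousLinearMap.inr ℝ _ _) = charFun (residualLaw e hs T hε prior m) u := by
    rw [charFunDual_apply, charFun_apply]
    simp_rw [hL2, real_inner_comm u]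
  rw [hdual, charFun_residualLaw e hs T hε hmean hC hmm hm, charFunDual_apply, charFunDual_apply,
    integral_map (hGm.prodMk hDm).aemeasurable (by fun_prop),
    integral_map hGm.aemeasurable (by fun_prop)]
  have h1 : ∫ p, Complex.exp ((L ∘L ContinuousLinearMap.inl ℝ _ _) (observation e hs T hε p) *
      Complex.I) ∂prior.prod Q =
      Complex.exp (-(⟪C (T.adjoint h), T.adjoint h⟫ + ‖h‖ ^ 2 : ℝ) / 2) := by
    rw [← integral_exp_prod hmean hC hε]
    refine integral_congr_ae ?_
    filter_upwards [hh] with p hp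
    rw [hp]
  set w := u - T.adjoint (cogain C T u) with hw
  have h2 : ∫ p, Complex.exp (L (observation e hs T hε p, p.1 - m (observation e hs T hε p)) *
      Complex.I) ∂prior.prod Q =
      Complex.exp (-(⟪C (T.adjoint h + w), T.adjoint h + w⟫ + ‖h + -cogain C T u‖ ^ 2 : ℝ) / 2) := by
    rw [← integral_exp_prod hmean hC hε]
    refine integral_congr_ae ?_
    filter_upwards [hh, hD, ae_prod_of_ae_snd (hε.map_add_ae h (-cogain C T u))] with p h1 h2 h3
    have hsplit : L (observation e hs T hε p, p.1 - m (observation e hs T hε p)) =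
        (L ∘L ContinuousLinearMap.inl ℝ _ _) (observation e hs T hε p) +
          (L ∘L ContinuousLinearMap.inr ℝ _ _) (p.1 - m (observation e hs T hε p)) := by
      simp [← map_add]
    rw [hsplit, h1, hL2, h2, h3, inner_add_left]
    congr 3
    ring
  rw [h1, h2, ← Complex.exp_add, ← inner_posteriorCovariance T hC]
  have hcross := inner_residual T hC h u
  rw [← hw] at hcross ⊢
  have hcross' : ⟪C w, T.adjoint h⟫ = ⟪h, cogain C T u⟫ := by
    rw [hC.inner_comm, real_inner_comm, hcross]
  -- The cross terms are `2⟪h, cogain C T u⟫` from the prior and its negative from the noise.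
  have hreal : ⟪C (T.adjoint h + w), T.adjoint h + w⟫ + ‖h + -cogain C T u‖ ^ 2 =
      (⟪C (T.adjoint h), T.adjoint h⟫ + ‖h‖ ^ 2) + (⟪C w, w⟫ + ‖cogain C T u‖ ^ 2) := by
    rw [← sub_eq_add_neg, norm_sub_sq_real, map_add, inner_add_left, inner_add_right,
      inner_add_right, hcross, hcross']
    ring
  rw [hreal]
  congr 1
  push_cast
  ring

/-- Replaces the abstract joint law by an explicit model on the product space, where prior and noise
are independent coordinates. -/
theorem compProd_likelihood :
    prior ⊗ₘ likelihood (toScale e hs ∘L T) (Q.map (realisation e s ε)) =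
      (prior.prod Q).map fun p => (p.1, observation e hs T hε p) := by
  have hR : Measurable (hε.noiseSeries e (toScale e hs)) := (Lp.stronglyMeasurable _).measurable
  have hprob : IsProbabilityMeasure (Q.map (realisation e s ε)) :=
    Measure.isProbabilityMeasure_map (aemeasurable_realisation hs hε)
  have hlik : IsMarkovKernel
      (likelihood (toScale e hs ∘L T) (Q.map (realisation e s ε))) :=
    ⟨fun u => Measure.isProbabilityMeasure_map (by fun_prop)⟩
  rw [compProd_eq_map_prod _ _ (toScale e hs ∘L T).measurable _ (fun _ => rfl),
    Measure.map_congr (realisation_ae_eq hs hε)]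
  have hid : prior.prod (Q.map (hε.noiseSeries e (toScale e hs))) =
      (prior.prod Q).map (Prod.map id (hε.noiseSeries e (toScale e hs))) := by
    rw [← Measure.map_prod_map _ _ measurable_id hR, Measure.map_id]
  rw [hid, Measure.map_map (by fun_prop) (measurable_id.prodMap hR)]
  rfl

theorem exists_posteriorKernel (hmean : ∫ u, u ∂prior = 0) (hC : HasCovariance prior C) :
    ∃ κ : Kernel (HilbertScale J (-s)) U, IsMarkovKernel κ ∧
      (prior.prod Q).map (fun p => (observation e hs T hε p, p.1)) =
        (prior.prod Q).map (observation e hs T hε) ⊗ₘ κ ∧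
      ∀ z, IsGaussian (κ z) ∧ HasCovariance (κ z) (posteriorCovariance C T) := by
  obtain ⟨m, hmm, hm⟩ := exists_posteriorMean e hs T hε hC
  obtain ⟨hN, hcov⟩ := isGaussian_residualLaw e hs T hε hmean hC hmm hm
  set N := residualLaw e hs T hε prior m with hNdef
  have hκ := shiftKernel_apply m hmm N
  have hmarkov : IsMarkovKernel (shiftKernel m hmm N) :=
    ⟨fun z => by rw [hκ]; exact Measure.isProbabilityMeasure_map (by fun_prop)⟩
  have hgauss : ∀ z, IsGaussian (shiftKernel m hmm N z) := fun z => by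
    rw [hκ]; infer_instance
  refine ⟨shiftKernel m hmm N, hmarkov, ?_, fun z => ⟨hgauss z, ?_, fun u v => ?_⟩⟩
  · have hGm := measurable_observation e hs T hε
    have hDm := measurable_residual e hs T hε hmm
    -- Independence turns the product law into the joint law of data and residual; adding `m` of the
    -- data to the residual recovers the parameter.
    rw [compProd_eq_map_prod _ m hmm N hκ, ← map_observation_residual e hs T hε hmean hC hmm hm,
      Measure.map_map (by fun_prop) (hGm.prodMk hDm)]
    congr 1
    funext p
    simp
  · have := hgauss z
    exact IsGaussian.memLp_two_id
  · rw [hκ, covarianceBilin_map_const_add, hcov.2]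

end Posterior

end WhiteNoiseModel

end

/-! ### Transfer to an arbitrary pair with the prescribed joint law -/

open WhiteNoiseModel in
theorem mainTheorem2
    {𝒳 H U Ω Ω' : Type*} [MeasurableSpace 𝒳]
    -- the reproducing kernel Hilbert space `H` on `𝒳`, and the measure `μ`
    [NormedAddCommGroup H] [InnerProductSpace ℝ H] [CompleteSpace H] [RKHS ℝ H 𝒳 ℝ]
    (hk : IsAdmissibleKernel H) (μ : Measure 𝒳) [IsFiniteMeasure μ]
    -- the separable Hilbert space `U` and the forward map
    [NormedAddCommGroup U] [InnerProductSpace ℝ U] [CompleteSpace U]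
    [TopologicalSpace.SeparableSpace U] [MeasurableSpace U] [BorelSpace U]
    (A : U →L[ℝ] H) (Aμ : U →L[ℝ] Lp ℝ 2 μ) (hAμ : Aμ = embedding hk μ ∘L A)
    -- an orthonormal basis of `L²(μ)` and the exponent of the Hilbert scale
    (J : Set ℕ+) (e : HilbertBasis J ℝ (Lp ℝ 2 μ)) (s : ℝ)
    (hs : Summable fun j : J => ((j : ℕ+) : ℝ) ^ (-2 * s))
    -- the prior `N(0, C_f)`
    (prior : Measure U) [IsGaussian prior] (hmean : ∫ u, u ∂prior = 0)
    (Cf : U →L[ℝ] U) (hCf : HasCovariance prior Cf)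
    -- the white noise
    [MeasurableSpace Ω'] (Q : Measure Ω') [IsProbabilityMeasure Q]
    (ε : Lp ℝ 2 μ → Ω' → ℝ) (hε : IsIsonormal ε Q)
    -- the pair `(f, g)` with the joint law given by the prior and the likelihood
    [MeasurableSpace Ω] (P : Measure Ω) [IsProbabilityMeasure P]
    (f : Ω → U) (g : Ω → HilbertScale J (-s))
    (hfg : HasLaw (fun ω => (f ω, g ω))
      (prior ⊗ₘ likelihood (toScale e hs ∘L Aμ) (Q.map (realisation e s ε))) P) :
    -- the noise `∑ ε(e_j) e_j` converges in `L²(Q; Z_{-s})` and realises `ε` on `Z_s`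
    (AEMeasurable (realisation e s ε) Q ∧
      Tendsto (fun F : Finset J => eLpNorm (fun ω =>
        realisation e s ε ω - ∑ j ∈ F, ε (e j) ω • toScale e hs (e j)) 2 Q) atTop (𝓝 0) ∧
      ∀ h : Lp ℝ 2 μ, (fun j => e.repr h j) ∈ scaleSubmodule J s →
        ∀ᵐ ω ∂Q, HasSum (fun j : J => (realisation e s ε ω).coeff j * e.repr h j) (ε h ω)) ∧
    -- the operator inverse in the formula is well defined, and the posterior covariance
    -- is trace class
    IsUnit (dataCovariance Cf Aμ) ∧
    IsTraceClass (posteriorCovariance Cf Aμ) ∧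
    -- there is a regular version of the conditional distribution of `f` given `g`, and it is
    -- Gaussian with that covariance for every value of `g`
    ∃ κ : Kernel (HilbertScale J (-s)) U, IsMarkovKernel κ ∧
      P.map (fun ω => (g ω, f ω)) = P.map g ⊗ₘ κ ∧
      ∀ z, IsGaussian (κ z) ∧ HasCovariance (κ z) (posteriorCovariance Cf Aμ) := by
  have : SecondCountableTopology U := UniformSpace.secondCountable_of_separable U
  obtain ⟨κ, hκ, hcond, hgauss⟩ := exists_posteriorKernel e hs Aμ hε hmean hCf
  refine ⟨⟨aemeasurable_realisation hs hε, tendsto_eLpNorm_realisation hs hε,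
    hasSum_coeff_realisation hs hε⟩, hCf.isUnit_dataCovariance Aμ, ?_, κ, hκ, ?_, hgauss⟩
  -- Any data value would do: the operator is the covariance of the Gaussian measure `κ 0`.
  · have := (hgauss 0).1
    exact (hgauss 0).2.isTraceClass
  · have hG := measurable_observation e hs Aμ hε
    have hlaw := hfg.map_eq
    rw [compProd_likelihood e hs Aμ hε] at hlaw
    have hg : P.map g = (prior.prod Q).map (observation e hs Aμ hε) := by
      have h := congrArg (Measure.map Prod.snd) hlaw
      rwa [AEMeasurable.map_map_of_aemeasurable (by fun_prop) hfg.aemeasurable,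
        Measure.map_map (by fun_prop) (measurable_fst.prodMk hG)] at h
    have hgf : P.map (fun ω => (g ω, f ω)) =
        (prior.prod Q).map fun p => (observation e hs Aμ hε p, p.1) := by
      have h := congrArg (Measure.map Prod.swap) hlaw
      rwa [AEMeasurable.map_map_of_aemeasurable (by fun_prop) hfg.aemeasurable,
        Measure.map_map (by fun_prop) (measurable_fst.prodMk hG)] at h
    rw [hgf, hg, hcond]
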